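/- For $n,m\in\mathbb{N}$ let $\mathrm{MonCNF}_m$ over $n$ Boolean variables be the set of propositional formulas in conjunctive normal form with at most $m$ clauses in which all literals are negative. A (deterministic, computationally unrestricted) learner knows $n$ and has to identify, up to equivalence, an unknown formula $\varphi\in\mathcal L_n:=\mathrm{MonCNF}_n$ over $n$ variables, by adaptively querying a teacher on candidate formulas $\theta$ over these variables. In an \emph{equivalence query} the teacher answers ``equivalent'' if $\theta\equiv\varphi$, and otherwise returns a state $\sigma$ on which $\theta$ and $\varphi$ differ. In an \emph{ICE-equivalence query} the teacher answers ``equivalent'' if $\theta\equiv\varphi$, and otherwise returns a pair of states $(\sigma,\sigma')$ such that $\sigma\models\theta$, $\sigma'\not\models\theta$, and $\sigma\not\models\varphi$ or $\sigma'\models\varphi$ (if no such pair exists, which happens only if $\theta$ is valid or unsatisfiable, it just answers ``not equivalent''). The number of queries is counted in the worst case over all targets $\varphi\in\mathcal L_n$ and all teachers that answer correctly. 1. There is a function $q(n)=2^{o(n)}$ such that for every $n$ some learner exactly learns $\mathcal L_n$ with at most $q(n)$ equivalence queries, all of whose candidates are monotone CNF formulas (in the above sense) with at most $q(n)$ clauses.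 2. There is a constant $c>0$ such that for all sufficiently large $n$, every learner that exactly learns $\mathcal L_n$ with ICE-equivalence queries, even if its candidates are arbitrary propositional formulas, needs at least $2^{cn}$ queries in the worst case. -/

import Mathlib

/-- Propositional formulas over the vocabulary `V`. -/
inductive PropFormula (V : Type) : Type
  | tru : PropFormula V
  | fls : PropFormula V
  | var : V → PropFormula V
  | neg : PropFormula V → PropFormula V
  | conj : PropFormula V → PropFormula V → PropFormula V
  | disj : PropFormula V → PropFormula V → PropFormula V

namespace PropFormula

variable {V : Type}

/-- `φ.Sat σ`: the state (valuation) `σ` satisfies `φ`. -/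
def Sat : PropFormula V → (V → Bool) → Prop
  | tru, _ => True
  | fls, _ => False
  | var v, σ => σ v = true
  | neg φ, σ => ¬ φ.Sat σ
  | conj φ ψ, σ => φ.Sat σ ∧ ψ.Sat σ
  | disj φ ψ, σ => φ.Sat σ ∨ ψ.Sat σ

/-- Logical equivalence. -/
def Equivalent (φ ψ : PropFormula V) : Prop := ∀ σ : V → Bool, φ.Sat σ ↔ ψ.Sat σ

end PropFormula

/-- A literal: a variable, taken positively or negatively. -/
structure PropLiteral (V : Type) : Type where
  atom : V
  positive : Bool

/-- The formula denoted by a literal. -/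
def PropLiteral.toFormula {V : Type} (l : PropLiteral V) : PropFormula V :=
  if l.positive then .var l.atom else .neg (.var l.atom)

/-- The disjunction of a list of literals (a clause); the empty clause is `fls`. -/
def clauseFormula {V : Type} (c : List (PropLiteral V)) : PropFormula V :=
  (c.map PropLiteral.toFormula).foldr .disj .fls

/-- The conjunction of a list of clauses; the empty conjunction is `tru`. -/
def cnfFormula {V : Type} (C : List (List (PropLiteral V))) : PropFormula V :=
  (C.map clauseFormula).foldr .conj .tru

/-- Monotone CNF formulas with at most `m` clauses: all literals are negative. -/
def MonCNF (V : Type) (m : ℕ) : Set (PropFormula V) :=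
  {φ | ∃ C : List (List (PropLiteral V)), C.length ≤ m ∧
    (∀ c ∈ C, ∀ l ∈ c, l.positive = false) ∧ φ = cnfFormula C}

/-- What a learner does next: query a candidate, or halt with an output. -/
inductive LearnerAction (V : Type) : Type
  | query : PropFormula V → LearnerAction V
  | output : PropFormula V → LearnerAction V

/-- A (deterministic, computationally unrestricted) learner over the vocabulary `V` whose queries
are answered by elements of `R`: its next action is a function of the queries and answers so far. -/
structure Learner (V R : Type) : Type where
  act : List (PropFormula V × R) → LearnerAction V

namespace Learner

variable {V R : Type}

/-- The queries and answers of the first `k` steps of the learner `A` interacting with the teacher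
`T`; once the learner has halted, the transcript no longer changes. -/
def transcript (A : Learner V R) (T : PropFormula V → R) : ℕ → List (PropFormula V × R)
  | 0 => []
  | k + 1 =>
    match A.act (A.transcript T k) with
    | .query θ => A.transcript T k ++ [(θ, T θ)]
    | .output _ => A.transcript T k

/-- Every candidate that the learner queries belongs to `K`. -/
def QueriesIn (A : Learner V R) (K : Set (PropFormula V)) : Prop :=
  ∀ h θ, A.act h = .query θ → θ ∈ K

/-- `A` exactly learns every formula of the class `L` with at most `t` queries in the worst case:
for every target `φ ∈ L` and every teacher `T` that is admissible for `φ`, the learner has halted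
after at most `t` queries, and its output is equivalent to `φ`. -/
def LearnsWithin (A : Learner V R) (admissible : PropFormula V → (PropFormula V → R) → Prop)
    (L : Set (PropFormula V)) (t : ℕ) : Prop :=
  ∀ φ ∈ L, ∀ T, admissible φ T →
    ∃ ψ, A.act (A.transcript T t) = .output ψ ∧ ψ.Equivalent φ

end Learner

/-- Answers to an equivalence query: `equivalent`, or a state as a counterexample. -/
inductive EqAnswer (V : Type) : Type
  | equivalent : EqAnswer V
  | counterexample : (V → Bool) → EqAnswer V

/-- `a` is a correct answer to the equivalence query `θ` when the target is `φ`. -/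
def EqAnswer.Correct {V : Type} (φ θ : PropFormula V) : EqAnswer V → Prop
  | .equivalent => θ.Equivalent φ
  | .counterexample σ => (θ.Sat σ ∧ ¬ φ.Sat σ) ∨ (¬ θ.Sat σ ∧ φ.Sat σ)

/-- `T` answers equivalence queries for the target `φ`. -/
def IsEquivalenceTeacher {V : Type} (φ : PropFormula V) (T : PropFormula V → EqAnswer V) : Prop :=
  ∀ θ, (T θ).Correct φ θ

/-- `(σ, σ')` is an implication counterexample to the candidate `θ` for the target `φ`. -/
def IsImplicationCex {V : Type} (φ θ : PropFormula V) (σ σ' : V → Bool) : Prop :=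
  θ.Sat σ ∧ ¬ θ.Sat σ' ∧ (¬ φ.Sat σ ∨ φ.Sat σ')

/-- Answers to an ICE-equivalence query: `equivalent`, an implication counterexample, or just
`inequivalent`. -/
inductive IceAnswer (V : Type) : Type
  | equivalent : IceAnswer V
  | implication : (V → Bool) → (V → Bool) → IceAnswer V
  | inequivalent : IceAnswer V

/-- `a` is a correct answer to the ICE-equivalence query `θ` when the target is `φ`. The bare answer
`inequivalent` is allowed only if there is no implication counterexample at all, which for
inequivalent `θ` and `φ` happens exactly when `θ` is valid or unsatisfiable. -/
def IceAnswer.Correct {V : Type} (φ θ : PropFormula V) : IceAnswer V → Prop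
  | .equivalent => θ.Equivalent φ
  | .implication σ σ' => IsImplicationCex φ θ σ σ'
  | .inequivalent => ¬ θ.Equivalent φ ∧ ¬ ∃ σ σ', IsImplicationCex φ θ σ σ'

/-- `T` answers ICE-equivalence queries for the target `φ`. -/
def IsIceTeacher {V : Type} (φ : PropFormula V) (T : PropFormula V → IceAnswer V) : Prop :=
  ∀ θ, (T θ).Correct φ θ

/-- `q(n) = 2^{o(n)}`. -/
def Subexponential (q : ℕ → ℕ) : Prop :=
  ∀ ε : ℝ, 0 < ε → ∀ᶠ n : ℕ in Filter.atTop, (q n : ℝ) ≤ (2 : ℝ) ^ (ε * n)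

/-! Negating formulas turns targets into monotone DNFs, given by families of at most `n` terms (sets
of variables).

For equivalence queries, the learner keeps the families consistent with all answers. Let `P` and `N`
be the points that all but a fraction below `1 / D` of these families cover, respectively leave
uncovered. By a union bound, any `D` points of `P` and `N` are classified correctly by a single
family, hence by at most `n` terms. The core, `exists_separates_of_locallySeparable`, turns this
local separability into one DNF of subexponential size separating all of `P` from `N`. It takes
every unrefuted term of length at most `k`; on positive points left uncovered only long terms
matter, so some variable `v` lies in a `k / (n + 1)` fraction of them. Setting `v = 0` shrinks the
number of terms geometrically, while setting `v = 1` uses up a variable. With `k` about `√n` this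
gives size `2^{O(√n log² n)}`. A counterexample to the separating DNF leaves at most a `1 - 1 / D`
fraction of the families, so about `D n²` queries suffice.

For ICE queries, the targets are the proper initial segments of the colexicographic order on states.
A pair of consecutive states refutes a candidate for all thresholds but one
(`exists_universal_answer`), so each query eliminates at most one of `2 ^ n - 1` targets. -/

/-! ### Monotone CNF formulas as families of terms -/

/-- The set of variables that the state `σ` makes true. -/
def trueSet {V : Type} [Fintype V] (σ : V → Bool) : Finset V :=
  Finset.univ.filter (fun v => σ v = true)

/-- Some member of `H` is contained in `x`: the monotone DNF with terms `H` is true at `x`. -/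
def Covers {V : Type} (H : Finset (Finset V)) (x : Finset V) : Prop :=
  ∃ T ∈ H, T ⊆ x

instance {V : Type} [DecidableEq V] (H : Finset (Finset V)) (x : Finset V) :
    Decidable (Covers H x) :=
  inferInstanceAs (Decidable (∃ T ∈ H, T ⊆ x))

lemma mem_trueSet {V : Type} [Fintype V] {σ : V → Bool} {v : V} :
    v ∈ trueSet σ ↔ σ v = true := by
  simp [trueSet]

lemma trueSet_decide_mem {V : Type} [Fintype V] [DecidableEq V] (x : Finset V) :
    trueSet (fun v => decide (v ∈ x)) = x := by
  ext v; simp [mem_trueSet]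

lemma sat_clauseFormula {V : Type} (c : List (PropLiteral V)) (σ : V → Bool) :
    (clauseFormula c).Sat σ ↔ ∃ l ∈ c, l.toFormula.Sat σ := by
  induction c with
  | nil => simp [clauseFormula, PropFormula.Sat]
  | cons l c ih =>
    have : clauseFormula (l :: c) = .disj l.toFormula (clauseFormula c) := rfl
    simp [this, PropFormula.Sat, ih]

lemma sat_cnfFormula {V : Type} (C : List (List (PropLiteral V))) (σ : V → Bool) :
    (cnfFormula C).Sat σ ↔ ∀ c ∈ C, ∃ l ∈ c, l.toFormula.Sat σ := by
  induction C with
  | nil => simp [cnfFormula, PropFormula.Sat]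
  | cons c C ih =>
    have : cnfFormula (c :: C) = .conj (clauseFormula c) (cnfFormula C) := rfl
    simp [this, PropFormula.Sat, ih, sat_clauseFormula]

/-- The monotone CNF formula whose clauses are the negated members of `H`. -/
noncomputable def monotoneCNF {V : Type} (H : Finset (Finset V)) : PropFormula V :=
  cnfFormula (H.toList.map fun S => S.toList.map fun v => ⟨v, false⟩)

lemma sat_toFormula_of_negative {V : Type} {l : PropLiteral V} (hl : l.positive = false)
    (σ : V → Bool) : l.toFormula.Sat σ ↔ σ l.atom = false := by
  simp [PropLiteral.toFormula, hl, PropFormula.Sat]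

lemma monotoneCNF_mem {V : Type} {H : Finset (Finset V)} {m : ℕ} (h : H.card ≤ m) :
    monotoneCNF H ∈ MonCNF V m := by
  refine ⟨_, ?_, ?_, rfl⟩
  · simpa using h
  · intro c hc l hl
    obtain ⟨S, -, rfl⟩ := List.mem_map.1 hc
    obtain ⟨v, -, rfl⟩ := List.mem_map.1 hl
    rfl

lemma sat_monotoneCNF {V : Type} [Fintype V] (H : Finset (Finset V)) (σ : V → Bool) :
    (monotoneCNF H).Sat σ ↔ ¬ Covers H (trueSet σ) := by
  simp [monotoneCNF, sat_cnfFormula, Covers, Finset.subset_iff, mem_trueSet,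
    sat_toFormula_of_negative]

lemma exists_terms_of_mem_monCNF {V : Type} [Fintype V] [DecidableEq V] {φ : PropFormula V}
    {m : ℕ} (h : φ ∈ MonCNF V m) :
    ∃ H : Finset (Finset V), H.card ≤ m ∧ ∀ σ, φ.Sat σ ↔ ¬ Covers H (trueSet σ) := by
  obtain ⟨C, hC, hneg, rfl⟩ := h
  refine ⟨(C.map fun c => (c.map PropLiteral.atom).toFinset).toFinset, ?_, fun σ => ?_⟩
  · exact (List.toFinset_card_le _).trans (by simpa using hC)
  · rw [sat_cnfFormula]
    simp only [Covers, List.mem_toFinset, List.mem_map, Finset.subset_iff, mem_trueSet]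
    push Not
    constructor
    · rintro h _ ⟨c, hc, rfl⟩
      obtain ⟨l, hl, hs⟩ := h c hc
      rw [sat_toFormula_of_negative (hneg c hc l hl)] at hs
      exact ⟨l.atom, by simpa using ⟨l, hl, rfl⟩, by simp [hs]⟩
    · intro h c hc
      obtain ⟨v, hv, hs⟩ := h _ ⟨c, hc, rfl⟩
      obtain ⟨l, hl, rfl⟩ : ∃ l ∈ c, l.atom = v := by simpa using hv
      exact ⟨l, hl, by rw [sat_toFormula_of_negative (hneg c hc l hl)]; simpa using hs⟩

lemma card_filter_card_le {β : Type} [Fintype β] [DecidableEq β] (k : ℕ) :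
    (Finset.univ.filter fun S : Finset β => S.card ≤ k).card ≤ (Fintype.card β + 1) ^ k := by
  have hsub : (Finset.univ.filter fun S : Finset β => S.card ≤ k) ⊆
      (Finset.univ : Finset (Fin k → Option β)).image
        (fun f => Finset.univ.filter fun b => ∃ i, f i = some b) := by
    intro S hS
    have hk : S.card ≤ k := by simpa using hS
    -- A set of size at most `k` is the range of a `k`-tuple padded with `none`.
    refine Finset.mem_image.2 ⟨fun i => S.toList[(i : ℕ)]?, Finset.mem_univ _, ?_⟩
    ext b
    simp only [Finset.mem_filter, Finset.mem_univ, true_and]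
    constructor
    · rintro ⟨i, hi⟩
      exact Finset.mem_toList.1 (List.mem_of_getElem? hi)
    · intro hb
      obtain ⟨i, hi⟩ := List.mem_iff_getElem?.1 (Finset.mem_toList.2 hb)
      have hlt : i < S.toList.length := (List.getElem?_eq_some_iff.1 hi).1
      exact ⟨⟨i, by simp at hlt; omega⟩, hi⟩
  refine (Finset.card_le_card hsub).trans (Finset.card_image_le.trans ?_)
  simp

/-! ### From local to global separability -/

/-- The monotone DNF with terms `H` is true on `P` and false on `N`. -/
def Separates {V : Type} (H P N : Finset (Finset V)) : Prop :=
  (∀ x ∈ P, Covers H x) ∧ ∀ y ∈ N, ¬ Covers H y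

/-- Every subsample of at most `d` points of `P` and `N` is separated by at most `s` terms. -/
def LocallySeparable {V : Type} (s d : ℕ) (P N : Finset (Finset V)) : Prop :=
  ∀ P₀ ⊆ P, ∀ N₀ ⊆ N, P₀.card + N₀.card ≤ d → ∃ H, H.card ≤ s ∧ Separates H P₀ N₀

lemma LocallySeparable.mono {V : Type} {s d d' : ℕ} {P P' N : Finset (Finset V)}
    (h : LocallySeparable s d P N) (hP : P' ⊆ P) (hd : d' ≤ d) : LocallySeparable s d' P' N :=
  fun P₀ h₁ N₀ h₂ h₃ => h P₀ (h₁.trans hP) N₀ h₂ (h₃.trans hd)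

section Core

variable {V : Type} [Fintype V] [DecidableEq V]

/-- The sets that extend `M` by at most `k` elements and are not contained in a member of `N`. -/
def shortTerms (k : ℕ) (M : Finset V) (N : Finset (Finset V)) : Finset (Finset V) :=
  ((Finset.univ.filter fun S : Finset V => S.card ≤ k).image (M ∪ ·)).filter
    fun T => ∀ y ∈ N, ¬ T ⊆ y

lemma card_shortTerms_le (k : ℕ) (M : Finset V) (N : Finset (Finset V)) :
    (shortTerms k M N).card ≤ (Fintype.card V + 1) ^ k :=
  (Finset.card_filter_le _ _).trans (Finset.card_image_le.trans (card_filter_card_le k))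

lemma not_covers_shortTerms {k : ℕ} {M : Finset V} {N : Finset (Finset V)} {y : Finset V}
    (hy : y ∈ N) : ¬ Covers (shortTerms k M N) y := by
  rintro ⟨T, hT, hTy⟩
  exact (Finset.mem_filter.1 hT).2 y hy hTy

/-- A few members of `N` that refute every short term refuted by `N`. -/
lemma exists_refuting_subset (k : ℕ) (M : Finset V) (N : Finset (Finset V)) :
    ∃ W ⊆ N, W.card ≤ (Fintype.card V + 1) ^ k ∧
      ∀ T, (T \ M).card ≤ k → M ∪ T ∉ shortTerms k M N → ∃ y ∈ W, M ∪ T ⊆ y := by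
  -- `B` collects the short extensions of `M` that `N` refutes; one refuting point is kept for each.
  let B := (Finset.univ.filter fun S : Finset V => S.card ≤ k).filter
    fun S => ∃ y ∈ N, M ∪ S ⊆ y
  have hB : ∀ S ∈ B, ∃ y ∈ N, M ∪ S ⊆ y := fun S hS => (Finset.mem_filter.1 hS).2
  choose! w hwN hw using hB
  refine ⟨B.image w, ?_, ?_, ?_⟩
  · intro y hy
    obtain ⟨S, hS, rfl⟩ := Finset.mem_image.1 hy
    exact hwN S hS
  · exact Finset.card_image_le.trans ((Finset.card_filter_le _ _).trans (card_filter_card_le k))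
  · intro T hT hns
    have hMT : M ∪ T \ M = M ∪ T := Finset.union_sdiff_self_eq_union
    have hmem : T \ M ∈ B := by
      refine Finset.mem_filter.2 ⟨by simpa using hT, ?_⟩
      by_contra hcon
      push Not at hcon
      refine hns (Finset.mem_filter.2 ⟨Finset.mem_image.2 ⟨T \ M, by simpa using hT, hMT⟩, ?_⟩)
      rwa [hMT] at hcon
    exact ⟨w (T \ M), Finset.mem_image_of_mem _ hmem, hMT ▸ hw _ hmem⟩

/-- Among terms that have at least `k` elements outside `M`, some element outside `M` is
frequent. -/
lemma exists_frequent {k : ℕ} {M : Finset V} {F : Finset (Finset V)} (hF : F.Nonempty)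
    (hlong : ∀ T ∈ F, k < (T \ M).card) :
    ∃ v ∉ M, (F.filter (v ∉ ·)).card * (Fintype.card V + 1) ≤
      F.card * (Fintype.card V + 1 - k) := by
  obtain ⟨T₀, hT₀⟩ := hF
  have hpos := hlong T₀ hT₀
  -- Double counting of the incidences between terms of `F` and elements outside `M`.
  have hsum : F.card * k ≤ ∑ v ∈ Mᶜ, (F.filter (v ∈ ·)).card := by
    have h1 : ∑ v ∈ Mᶜ, (F.filter (v ∈ ·)).card = ∑ T ∈ F, (T \ M).card := by
      simp only [Finset.card_filter]
      rw [Finset.sum_comm]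
      refine Finset.sum_congr rfl fun T _ => ?_
      rw [← Finset.sum_filter, Finset.sum_const, smul_eq_mul, mul_one]
      congr 1; ext v; simp [and_comm]
    rw [h1, ← smul_eq_mul, ← Finset.sum_const]
    exact Finset.sum_le_sum fun T hT => (hlong T hT).le
  have hne : (Mᶜ : Finset V).Nonempty := by
    obtain ⟨v, hv⟩ := Finset.card_pos.1 (by omega : 0 < (T₀ \ M).card)
    exact ⟨v, by simpa using (Finset.mem_sdiff.1 hv).2⟩
  have hk : k ≤ Fintype.card V := hpos.le.trans (Finset.card_le_univ _)
  obtain ⟨v, hv, hmax⟩ := Finset.exists_max_image Mᶜ (fun v => (F.filter (v ∈ ·)).card) hne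
  refine ⟨v, by simpa using hv, ?_⟩
  have h2 : F.card * k ≤ (Fintype.card V + 1) * (F.filter (v ∈ ·)).card := by
    refine hsum.trans ((Finset.sum_le_card_nsmul _ _ _ hmax).trans ?_)
    rw [smul_eq_mul]
    exact Nat.mul_le_mul_right _ ((Finset.card_le_univ _).trans (Nat.le_succ _))
  have h3 := Finset.card_filter_add_card_filter_not (s := F) (v ∈ ·)
  obtain ⟨e, he⟩ := Nat.exists_eq_add_of_le (by omega : k ≤ Fintype.card V + 1)
  rw [he, Nat.add_sub_cancel_left]
  rw [he] at h2
  have h4 := congrArg (· * (k + e)) h3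
  nlinarith

/-- If the short terms do not cover everything, then some branch `v = 0` is locally separable with
fewer terms. -/
lemma exists_branch {k s d : ℕ} {M : Finset V} {P N P' : Finset (Finset V)} (hP : P' ⊆ P)
    (hM : ∀ x ∈ P', M ⊆ x) (hunc : ∀ x ∈ P', ¬ Covers (shortTerms k M N) x) (hne : P'.Nonempty)
    (h : LocallySeparable s ((Fintype.card V + 1) ^ k + 1 + Fintype.card V * d) P N) :
    ∃ v ∉ M, LocallySeparable (s * (Fintype.card V + 1 - k) / (Fintype.card V + 1)) d
      (P'.filter (v ∉ ·)) N := by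
  by_contra hcon
  push Not at hcon
  have hbad : ∀ v : V, ∃ P₀ N₀ : Finset (Finset V), P₀ ⊆ P'.filter (v ∉ ·) ∧ N₀ ⊆ N ∧
      P₀.card + N₀.card ≤ d ∧ (v ∉ M → ∀ H : Finset (Finset V),
        H.card ≤ s * (Fintype.card V + 1 - k) / (Fintype.card V + 1) → ¬ Separates H P₀ N₀) := by
    intro v
    by_cases hv : v ∈ M
    -- Elements of `M` are never branched on; empty samples make the choice total.
    · exact ⟨∅, ∅, by simp, by simp, by simp, fun h => (h hv).elim⟩
    · have := hcon v hv
      unfold LocallySeparable at this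
      push Not at this
      obtain ⟨P₀, h1, N₀, h2, h3, h4⟩ := this
      exact ⟨P₀, N₀, h1, h2, h3, fun _ => h4⟩
  choose A B hA hB hAB hbad using hbad
  obtain ⟨W, hWN, hWcard, hW⟩ := exists_refuting_subset k M N
  obtain ⟨x₀, hx₀⟩ := hne
  have hA' : ∀ v, A v ⊆ P' := fun v => (hA v).trans (Finset.filter_subset _ _)
  -- All failing samples are merged, together with the refuters `W` and one uncovered point, so that
  -- a single `H` serves every `v` at once.
  obtain ⟨H, hHs, hHP, hHN⟩ := h (insert x₀ (Finset.univ.biUnion A))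
    (by
      refine Finset.insert_subset (hP hx₀) (Finset.biUnion_subset.2 fun v _ => (hA' v).trans hP))
    (W ∪ Finset.univ.biUnion B)
    (Finset.union_subset hWN (Finset.biUnion_subset.2 fun v _ => hB v))
    (by
      have h1 : (insert x₀ (Finset.univ.biUnion A)).card ≤ ∑ v, (A v).card + 1 :=
        (Finset.card_insert_le _ _).trans (Nat.succ_le_succ Finset.card_biUnion_le)
      have h2 : (W ∪ Finset.univ.biUnion B).card ≤
          (Fintype.card V + 1) ^ k + ∑ v, (B v).card :=
        (Finset.card_union_le _ _).trans (Nat.add_le_add hWcard Finset.card_biUnion_le)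
      have h3 : ∑ v, (A v).card + ∑ v, (B v).card ≤ Fintype.card V * d := by
        rw [← Finset.sum_add_distrib]
        exact (Finset.sum_le_card_nsmul _ _ d fun v _ => hAB v).trans (by simp)
      omega)
  -- Only terms true somewhere on `P'` matter. A short one would give a short term covering a point
  -- of `P'`, or else be refuted by `W`.
  let F := H.filter fun T => ∃ x ∈ P', T ⊆ x
  have hFlong : ∀ T ∈ F, k < (T \ M).card := by
    intro T hT
    obtain ⟨hTH, x, hx, hTx⟩ := Finset.mem_filter.1 hT
    by_contra hle
    by_cases hs : M ∪ T ∈ shortTerms k M N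
    · exact hunc x hx ⟨_, hs, Finset.union_subset (hM x hx) hTx⟩
    · obtain ⟨y, hy, hTy⟩ := hW T (not_lt.1 hle) hs
      exact hHN y (Finset.mem_union_left _ hy)
        ⟨T, hTH, Finset.subset_union_right.trans hTy⟩
  have hFne : F.Nonempty := by
    obtain ⟨T, hT, hTx⟩ := hHP x₀ (Finset.mem_insert_self _ _)
    exact ⟨T, Finset.mem_filter.2 ⟨hT, x₀, hx₀, hTx⟩⟩
  obtain ⟨v, hvM, hv⟩ := exists_frequent hFne hFlong
  -- Points of `A v` omit `v`, so they are covered by terms avoiding `v`; these are few because `v`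
  -- is frequent.
  refine hbad v hvM (F.filter (v ∉ ·)) ?_ ⟨fun x hx => ?_, fun y hy => ?_⟩
  · rw [Nat.le_div_iff_mul_le (Nat.succ_pos _)]
    exact hv.trans (Nat.mul_le_mul_right _ ((Finset.card_filter_le _ _).trans hHs))
  · obtain ⟨T, hT, hTx⟩ := hHP x (Finset.mem_insert_of_mem
      (Finset.mem_biUnion.2 ⟨v, Finset.mem_univ _, hx⟩))
    exact ⟨T, Finset.mem_filter.2 ⟨Finset.mem_filter.2 ⟨hT, x, hA' v hx, hTx⟩,
      fun hvT => (Finset.mem_filter.1 (hA v hx)).2 (hTx hvT)⟩, hTx⟩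
  · rintro ⟨T, hT, hTy⟩
    exact hHN y (Finset.mem_union_right _ (Finset.mem_biUnion.2 ⟨v, Finset.mem_univ _, hy⟩))
      ⟨T, (Finset.mem_filter.1 (Finset.mem_filter.1 hT).1).1, hTy⟩

/-- Local separability by few terms implies separability by moderately many terms. -/
lemma exists_separates_of_locallySeparable (k j m s : ℕ) (M : Finset V)
    (P N : Finset (Finset V)) (hm : (Mᶜ : Finset V).card ≤ m) (hM : ∀ x ∈ P, M ⊆ x)
    (hs : s * (Fintype.card V + 1 - k) ^ j < (Fintype.card V + 1) ^ j)
    (h : LocallySeparable s (((Fintype.card V + 1) ^ k + 1) * (Fintype.card V + 1) ^ j) P N) :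
    ∃ H, H.card + (Fintype.card V + 1) ^ k ≤ (Fintype.card V + 1) ^ k * (m + 2) ^ j ∧
      Separates H P N := by
  set n := Fintype.card V with hn
  set K := (n + 1) ^ k with hK
  induction j generalizing m s M P with
  | zero =>
    -- With no terms available, local separability forces `P` to be empty.
    obtain rfl : s = 0 := by simpa using hs
    refine ⟨∅, by simp, fun x hx => ?_, fun y _ => by simp [Covers]⟩
    obtain ⟨H, hH, hsep⟩ := h {x} (by simpa using hx) ∅ (by simp) (by simp)
    obtain rfl : H = ∅ := by simpa using hH
    simpa [Covers] using hsep.1 x (by simp)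
  | succ j ihj =>
    induction m generalizing M P with
    | zero =>
      refine ⟨shortTerms k M N, ?_, ?_, fun y hy => not_covers_shortTerms hy⟩
      · have h1 := card_shortTerms_le k M N
        have h2 : 1 ≤ 2 ^ j := Nat.one_le_two_pow
        rw [zero_add, pow_succ]
        have h3 : K * 1 ≤ K * 2 ^ j := Nat.mul_le_mul_left _ h2
        rw [← hn, ← hK] at h1
        nlinarith
      · by_contra hcon
        push Not at hcon
        obtain ⟨x, hx, hxc⟩ := hcon
        -- Here `M` contains every variable, so an uncovered point would yield an impossible
        -- branching variable.
        obtain ⟨v, hv, -⟩ := exists_branch (k := k) (s := s) (d := 0) (M := M) (P := P) (N := N)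
          (P' := {x}) (by simpa using hx) (by simpa using hM x hx) (by simpa using hxc) (by simp)
          (h.mono subset_rfl (by
            rw [← hn, ← hK]; simpa using Nat.le_mul_of_pos_right (K + 1) (by positivity)))
        have : v ∈ (Mᶜ : Finset V) := by simpa using hv
        simp [Finset.card_eq_zero.1 (Nat.le_zero.1 hm)] at this
    | succ m ihm =>
      let P' := P.filter fun x => ¬ Covers (shortTerms k M N) x
      -- The sample budget at level `j + 1` pays for `K` refuters, one extra point and a failing
      -- sample of level `j` for each of the `n` variables.
      have hd : K + 1 + n * ((K + 1) * (n + 1) ^ j) ≤ (K + 1) * (n + 1) ^ (j + 1) := by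
        have h1 : 1 ≤ (n + 1) ^ j := Nat.one_le_pow _ _ (Nat.succ_pos _)
        have h2 : (K + 1) * 1 ≤ (K + 1) * (n + 1) ^ j := Nat.mul_le_mul_left _ h1
        rw [pow_succ]
        nlinarith
      have hcard := card_shortTerms_le k M N
      rw [← hn, ← hK] at hcard
      rcases P'.eq_empty_or_nonempty with hP' | hP'
      · refine ⟨shortTerms k M N, ?_, fun x hx => ?_, fun y hy => not_covers_shortTerms hy⟩
        · have h2 : 1 ≤ (m + 3) ^ j := Nat.one_le_pow _ _ (Nat.succ_pos _)
          have h3 : K * 1 ≤ K * (m + 3) ^ j := Nat.mul_le_mul_left _ h2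
          rw [show m + 1 + 2 = m + 3 from rfl, pow_succ]
          nlinarith
        · by_contra hc
          have : x ∈ P' := Finset.mem_filter.2 ⟨hx, hc⟩
          simp [hP'] at this
      · obtain ⟨v, hv, hbr⟩ := exists_branch (k := k) (s := s) (d := (K + 1) * (n + 1) ^ j)
          (M := M) (P := P) (N := N) (P' := P') (Finset.filter_subset _ _)
          (fun x hx => hM x (Finset.filter_subset _ _ hx))
          (fun x hx => (Finset.mem_filter.1 hx).2) hP' (h.mono subset_rfl hd)
        -- Branch `v = 0`: the term bound shrinks by the factor `(n + 1 - k) / (n + 1)`, using one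
        -- of the `j + 1` levels.
        obtain ⟨H₀, hH₀, hs₀⟩ := ihj (m + 1) _ M (P'.filter (v ∉ ·)) hm
          (fun x hx => hM x (Finset.filter_subset _ _ (Finset.filter_subset _ _ hx)))
          (by
            have h1 : s * (n + 1 - k) / (n + 1) * (n + 1) ≤ s * (n + 1 - k) :=
              Nat.div_mul_le_self _ _
            refine Nat.lt_of_mul_lt_mul_right (a := n + 1) ?_
            calc s * (n + 1 - k) / (n + 1) * (n + 1 - k) ^ j * (n + 1)
                = s * (n + 1 - k) / (n + 1) * (n + 1) * (n + 1 - k) ^ j := by ring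
              _ ≤ s * (n + 1 - k) * (n + 1 - k) ^ j := Nat.mul_le_mul_right _ h1
              _ = s * (n + 1 - k) ^ (j + 1) := by ring
              _ < (n + 1) ^ (j + 1) := hs
              _ = (n + 1) ^ j * (n + 1) := pow_succ _ _) hbr
        have hP1 : P'.filter (v ∈ ·) ⊆ P :=
          (Finset.filter_subset _ _).trans (Finset.filter_subset _ _)
        -- Branch `v = 1`: `v` joins `M`, and the term bound stays the same.
        obtain ⟨H₁, hH₁, hs₁⟩ := ihm (insert v M) (P'.filter (v ∈ ·))
          (by
            have : (insert v M)ᶜ = (Mᶜ : Finset V).erase v := by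
              ext w; simp
            rw [this, Finset.card_erase_of_mem (by simpa using hv)]
            omega)
          (fun x hx => Finset.insert_subset (Finset.mem_filter.1 hx).2 (hM x (hP1 hx)))
          (h.mono hP1 le_rfl)
        refine ⟨shortTerms k M N ∪ H₀ ∪ H₁, ?_, fun x hx => ?_, ?_⟩
        -- The summand `K` on the left of the claimed bound absorbs the short terms added at each
        -- node.
        · have h1 := Finset.card_union_le (shortTerms k M N ∪ H₀) H₁
          have h2 := Finset.card_union_le (shortTerms k M N) H₀
          have h3 : (m + 2) ^ (j + 1) ≤ (m + 2) * (m + 3) ^ j := by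
            rw [pow_succ, mul_comm]
            exact Nat.mul_le_mul_left _ (Nat.pow_le_pow_left (Nat.le_succ _) _)
          have h4 := Nat.mul_le_mul_left K h3
          rw [show m + 1 + 2 = m + 3 from rfl] at hH₀ ⊢
          have h5 : K * (m + 3) ^ (j + 1) = K * (m + 3) ^ j + K * ((m + 2) * (m + 3) ^ j) := by
            rw [pow_succ]; ring
          omega
        · by_cases hc : Covers (shortTerms k M N) x
          · obtain ⟨T, hT, hTx⟩ := hc
            exact ⟨T, by simp [hT], hTx⟩
          · have hx' : x ∈ P' := Finset.mem_filter.2 ⟨hx, hc⟩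
            by_cases hvx : v ∈ x
            · obtain ⟨T, hT, hTx⟩ := hs₁.1 x (Finset.mem_filter.2 ⟨hx', hvx⟩)
              exact ⟨T, by simp [hT], hTx⟩
            · obtain ⟨T, hT, hTx⟩ := hs₀.1 x (Finset.mem_filter.2 ⟨hx', hvx⟩)
              exact ⟨T, by simp [hT], hTx⟩
        · rintro y hy ⟨T, hT, hTy⟩
          rcases Finset.mem_union.1 hT with hT | hT
          · rcases Finset.mem_union.1 hT with hT | hT
            · exact not_covers_shortTerms hy ⟨T, hT, hTy⟩
            · exact hs₀.2 y hy ⟨T, hT, hTy⟩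
          · exact hs₁.2 y hy ⟨T, hT, hTy⟩

end Core

/-! ### The halving learner -/

/-- A hypothesis whose every counterexample refutes a `1 / D` fraction of a nonempty family of term
sets. -/
lemma exists_halving_terms {V : Type} [Fintype V] [DecidableEq V]
    {𝓥 : Finset (Finset (Finset V))} (hne : 𝓥.Nonempty) {k J s D : ℕ}
    (hcard : ∀ F ∈ 𝓥, F.card ≤ s)
    (hs : s * (Fintype.card V + 1 - k) ^ J < (Fintype.card V + 1) ^ J)
    (hD : ((Fintype.card V + 1) ^ k + 1) * (Fintype.card V + 1) ^ J ≤ D) :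
    ∃ H : Finset (Finset V), H.card ≤ (Fintype.card V + 1) ^ k * (Fintype.card V + 2) ^ J ∧
      ∀ x, (𝓥.filter fun F => (Covers F x ↔ ¬ Covers H x)).card * D ≤ (D - 1) * 𝓥.card := by
  let P : Finset (Finset V) :=
    Finset.univ.filter fun x => (𝓥.filter fun F => ¬ Covers F x).card * D < 𝓥.card
  let N : Finset (Finset V) :=
    Finset.univ.filter fun x => (𝓥.filter fun F => Covers F x).card * D < 𝓥.card
  have hDpos : 0 < D := lt_of_lt_of_le (by positivity) hD
  have hVpos : 0 < 𝓥.card := Finset.card_pos.2 hne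
  have hloc : LocallySeparable s D P N := by
    intro P₀ hP N₀ hN hc
    -- `B` contains the families that err on the sample; by the union bound it is not all of `𝓥`.
    let B := (P₀.biUnion fun x => 𝓥.filter fun F => ¬ Covers F x) ∪
      N₀.biUnion fun x => 𝓥.filter fun F => Covers F x
    have hB : B.card < 𝓥.card := by
      have h1 : B.card ≤ ∑ x ∈ P₀, (𝓥.filter fun F => ¬ Covers F x).card +
          ∑ x ∈ N₀, (𝓥.filter fun F => Covers F x).card :=
        (Finset.card_union_le _ _).trans
          (Nat.add_le_add Finset.card_biUnion_le Finset.card_biUnion_le)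
      have h2 : (∑ x ∈ P₀, (𝓥.filter fun F => ¬ Covers F x).card) * D ≤
          P₀.card * (𝓥.card - 1) := by
        rw [Finset.sum_mul, ← smul_eq_mul P₀.card]
        exact Finset.sum_le_card_nsmul _ _ _ fun x hx =>
          Nat.le_sub_one_of_lt (Finset.mem_filter.1 (hP hx)).2
      have h3 : (∑ x ∈ N₀, (𝓥.filter fun F => Covers F x).card) * D ≤
          N₀.card * (𝓥.card - 1) := by
        rw [Finset.sum_mul, ← smul_eq_mul N₀.card]
        exact Finset.sum_le_card_nsmul _ _ _ fun x hx =>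
          Nat.le_sub_one_of_lt (Finset.mem_filter.1 (hN hx)).2
      have h4 : B.card * D ≤ (𝓥.card - 1) * D := by
        calc B.card * D ≤ _ := Nat.mul_le_mul_right _ h1
          _ ≤ (P₀.card + N₀.card) * (𝓥.card - 1) := by rw [add_mul, add_mul]; omega
          _ ≤ D * (𝓥.card - 1) := Nat.mul_le_mul_right _ hc
          _ = _ := mul_comm _ _
      have := Nat.le_of_mul_le_mul_right h4 hDpos
      omega
    obtain ⟨F, hF, hFB⟩ := Finset.exists_mem_notMem_of_card_lt_card hB
    simp only [B, Finset.mem_union, Finset.mem_biUnion, Finset.mem_filter, not_or, not_exists,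
      not_and, not_not] at hFB
    exact ⟨F, hcard F hF, fun x hx => hFB.1 x hx hF, fun y hy => hFB.2 y hy hF⟩
  obtain ⟨H, hH, hsep⟩ := exists_separates_of_locallySeparable k J (Fintype.card V) s ∅ P N
    (by simp) (by simp) hs (hloc.mono subset_rfl hD)
  refine ⟨H, (Nat.le_add_right _ _).trans hH, fun x => ?_⟩
  by_contra hcon
  have h1 := Finset.card_filter_add_card_filter_not (s := 𝓥)
    fun F => (Covers F x ↔ ¬ Covers H x)
  -- If too many families disagreed with `H` at `x`, fewer than a `1 / D` fraction would agree,
  -- which puts `x` in `P` or `N` on the side where `H` is correct.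
  have h2 : (𝓥.filter fun F => ¬ (Covers F x ↔ ¬ Covers H x)).card * D < 𝓥.card := by
    obtain ⟨D, rfl⟩ := Nat.exists_eq_succ_of_ne_zero hDpos.ne'
    simp only [Nat.succ_eq_add_one, Nat.add_sub_cancel] at hcon ⊢
    have h4 := congrArg (· * (D + 1)) h1
    nlinarith
  by_cases hx : Covers H x
  · refine hsep.2 x (Finset.mem_filter.2 ⟨Finset.mem_univ _, ?_⟩) hx
    simpa [hx] using h2
  · refine hx (hsep.1 x (Finset.mem_filter.2 ⟨Finset.mem_univ _, ?_⟩))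
    simpa [hx] using h2

section Halving

variable {n : ℕ}

/-- The sets of at most `n` terms that agree with all counterexamples in the history `h`. -/
noncomputable def versionSpace (h : List (PropFormula (Fin n) × EqAnswer (Fin n))) :
    Finset (Finset (Finset (Fin n))) := by
  classical
  exact Finset.univ.filter fun F => F.card ≤ n ∧
    ∀ e ∈ h, ∀ σ, e.2 = .counterexample σ → (Covers F (trueSet σ) ↔ e.1.Sat σ)

lemma mem_versionSpace {h : List (PropFormula (Fin n) × EqAnswer (Fin n))}
    {F : Finset (Finset (Fin n))} :
    F ∈ versionSpace h ↔ F.card ≤ n ∧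
      ∀ e ∈ h, ∀ σ, e.2 = .counterexample σ → (Covers F (trueSet σ) ↔ e.1.Sat σ) := by
  simp [versionSpace]

lemma card_versionSpace_le (h : List (PropFormula (Fin n) × EqAnswer (Fin n))) :
    (versionSpace h).card ≤ (2 ^ n + 1) ^ n := by
  have : versionSpace h ⊆ Finset.univ.filter fun F => F.card ≤ n :=
    fun F hF => by simpa using (mem_versionSpace.1 hF).1
  simpa using (Finset.card_le_card this).trans (card_filter_card_le n)

/-- `H` has at most `b` terms, and every counterexample to it refutes a `1 / D` fraction of `𝓥`. -/
def IsHalving (b D : ℕ) (𝓥 : Finset (Finset (Finset (Fin n)))) (H : Finset (Finset (Fin n))) :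
    Prop :=
  H.card ≤ b ∧
    ∀ x, (𝓥.filter fun F => (Covers F x ↔ ¬ Covers H x)).card * D ≤ (D - 1) * 𝓥.card

open Classical in
/-- The hypothesis of the halving learner. -/
noncomputable def halvingTerms (b D : ℕ) (𝓥 : Finset (Finset (Finset (Fin n)))) :
    Finset (Finset (Fin n)) :=
  -- The default `∅` keeps the size bound valid on every history, including inconsistent ones.
  if h : ∃ H, IsHalving b D 𝓥 H then h.choose else ∅

lemma card_halvingTerms_le (b D : ℕ) (𝓥 : Finset (Finset (Finset (Fin n)))) :
    (halvingTerms b D 𝓥).card ≤ b := by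
  unfold halvingTerms
  split_ifs with h
  · exact h.choose_spec.1
  · simp

lemma isHalving_halvingTerms {b D : ℕ} {𝓥 : Finset (Finset (Finset (Fin n)))}
    (h : ∃ H, IsHalving b D 𝓥 H) : IsHalving b D 𝓥 (halvingTerms b D 𝓥) := by
  unfold halvingTerms
  rw [dif_pos h]
  exact h.choose_spec

open Classical in
/-- The learner that queries hypotheses which halve the version space, up to a factor, and outputs
the first one that is accepted. -/
noncomputable def halvingLearner (n b D : ℕ) : Learner (Fin n) (EqAnswer (Fin n)) where
  act h :=
    if he : ∃ e ∈ h, e.2 = .equivalent then .output he.choose.1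
    else .query (monotoneCNF (halvingTerms b D (versionSpace h)))

lemma halvingLearner_queriesIn (b D : ℕ) :
    (halvingLearner n b D).QueriesIn (MonCNF (Fin n) b) := by
  intro h θ hθ
  simp only [halvingLearner] at hθ
  split_ifs at hθ with he
  cases hθ
  exact monotoneCNF_mem (card_halvingTerms_le _ _ _)

lemma Learner.eq_of_mem_transcript {V R : Type} (A : Learner V R) (T : PropFormula V → R)
    (k : ℕ) : ∀ e ∈ A.transcript T k, e.2 = T e.1 := by
  induction k with
  | zero => simp [Learner.transcript]
  | succ k ih =>
    intro e he
    rw [Learner.transcript] at he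
    split at he
    · rcases List.mem_append.1 he with he | he
      · exact ih e he
      · obtain rfl := List.mem_singleton.1 he
        rfl
    · exact ih e he

/-- After `k` queries the halving learner has finished, or its version space has shrunk. -/
lemma halvingLearner_progress {b D : ℕ}
    (hhalf : ∀ 𝓥 : Finset (Finset (Finset (Fin n))), 𝓥.Nonempty → (∀ F ∈ 𝓥, F.card ≤ n) →
      ∃ H, IsHalving b D 𝓥 H)
    {φ : PropFormula (Fin n)} {T : PropFormula (Fin n) → EqAnswer (Fin n)}
    (hT : IsEquivalenceTeacher φ T) {F₀ : Finset (Finset (Fin n))} (hF₀ : F₀.card ≤ n)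
    (hφ : ∀ σ, φ.Sat σ ↔ ¬ Covers F₀ (trueSet σ)) (k : ℕ) :
    (∃ ψ, (halvingLearner n b D).act ((halvingLearner n b D).transcript T k) = .output ψ ∧
      ψ.Equivalent φ) ∨
    (versionSpace ((halvingLearner n b D).transcript T k)).card * D ^ k ≤
      (D - 1) ^ k * (2 ^ n + 1) ^ n := by
  set A := halvingLearner n b D with hA
  induction k with
  | zero =>
    right
    simpa using card_versionSpace_le _
  | succ k ih =>
    by_cases hfin : ∃ e ∈ A.transcript T (k + 1), e.2 = .equivalent
    · left
      refine ⟨hfin.choose.1, ?_, ?_⟩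
      · exact dif_pos hfin
      · have h1 := A.eq_of_mem_transcript T (k + 1) _ hfin.choose_spec.1
        have h2 := hT hfin.choose.1
        rw [← h1, hfin.choose_spec.2] at h2
        exact h2
    · rcases ih with ⟨ψ, hψ, he⟩ | ih
      · left
        have : A.transcript T (k + 1) = A.transcript T k := by
          rw [Learner.transcript, hψ]
        exact ⟨ψ, by rw [this]; exact hψ, he⟩
      · right
        set h := A.transcript T k with hh
        set H := halvingTerms b D (versionSpace h) with hH
        have hnot : ¬ ∃ e ∈ h, e.2 = .equivalent := by
          rintro ⟨e, he, hee⟩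
          refine hfin ⟨e, ?_, hee⟩
          rw [Learner.transcript]
          split
          · exact List.mem_append_left _ he
          · exact he
        have hact : A.act h = .query (monotoneCNF H) := by
          exact dif_neg hnot
        have hnext : A.transcript T (k + 1) = h ++ [(monotoneCNF H, T (monotoneCNF H))] := by
          rw [Learner.transcript, ← hh, hact]
        have hmem : F₀ ∈ versionSpace h := by
          refine mem_versionSpace.2 ⟨hF₀, fun e he σ hσ => ?_⟩
          have h1 := hT e.1
          rw [← A.eq_of_mem_transcript T k e he, hσ] at h1
          have h2 := hφ σ
          simp only [EqAnswer.Correct] at h1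
          tauto
        have hhalf' := isHalving_halvingTerms (hhalf (versionSpace h) ⟨F₀, hmem⟩
          fun F hF => (mem_versionSpace.1 hF).1)
        rw [← hH] at hhalf'
        obtain ⟨σ, hσ⟩ : ∃ σ, T (monotoneCNF H) = .counterexample σ := by
          cases hTH : T (monotoneCNF H) with
          | equivalent => exact (hfin ⟨(monotoneCNF H, T (monotoneCNF H)), by simp [hnext], hTH⟩).elim
          | counterexample σ => exact ⟨σ, rfl⟩
        -- At a counterexample the target differs from the query, so the surviving families are
        -- those that disagree with `H` there.
        have hsub : versionSpace (A.transcript T (k + 1)) ⊆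
            (versionSpace h).filter fun F => (Covers F (trueSet σ) ↔ ¬ Covers H (trueSet σ)) := by
          intro F hF
          obtain ⟨h1, h2⟩ := mem_versionSpace.1 hF
          rw [hnext] at h2
          refine Finset.mem_filter.2 ⟨mem_versionSpace.2
            ⟨h1, fun e he => h2 e (List.mem_append_left _ he)⟩, ?_⟩
          rw [← sat_monotoneCNF]
          exact h2 _ (List.mem_append_right _ (List.mem_singleton_self _)) σ hσ
        calc (versionSpace (A.transcript T (k + 1))).card * D ^ (k + 1)
            ≤ _ * D ^ (k + 1) := Nat.mul_le_mul_right _ (Finset.card_le_card hsub)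
          _ = _ * D * D ^ k := by rw [pow_succ, mul_assoc, mul_comm D]
          _ ≤ (D - 1) * (versionSpace h).card * D ^ k :=
              Nat.mul_le_mul_right _ (hhalf'.2 (trueSet σ))
          _ = (D - 1) * ((versionSpace h).card * D ^ k) := by rw [mul_assoc]
          _ ≤ (D - 1) * ((D - 1) ^ k * (2 ^ n + 1) ^ n) := Nat.mul_le_mul_left _ ih
          _ = _ := by rw [pow_succ]; ring

/-- `(1 - k / N) ^ a ≤ exp (-a k / N) ≤ exp (-1) ≤ 1 / 2`. It serves both the shrinking of the
version space (`k = 1`) and the shrinking of the term bound. -/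
lemma two_mul_sub_pow_le {N k a : ℕ} (ha : N ≤ a * k) (hk : k ≤ N) (hN : 0 < N) :
    2 * (N - k) ^ a ≤ N ^ a := by
  have hN' : (0 : ℝ) < N := by exact_mod_cast hN
  have h1 : ((N : ℝ) - k) / N ≤ Real.exp (-(k / N)) := by
    have := Real.add_one_le_exp (-((k : ℝ) / N))
    rw [sub_div, div_self hN'.ne']
    linarith
  have h0 : 0 ≤ ((N : ℝ) - k) / N :=
    div_nonneg (sub_nonneg.2 (by exact_mod_cast hk)) hN'.le
  have h2 : (((N : ℝ) - k) / N) ^ a ≤ Real.exp (-1) := by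
    refine (pow_le_pow_left₀ h0 h1 a).trans ?_
    rw [← Real.exp_nat_mul]
    refine Real.exp_le_exp.2 ?_
    have : (1 : ℝ) ≤ a * k / N := by
      rw [le_div_iff₀ hN', one_mul]
      exact_mod_cast ha
    have h3 : (a : ℝ) * -(k / N) = -(a * k / N) := by ring
    linarith
  have h3 : Real.exp (-1) ≤ 1 / 2 := by
    rw [Real.exp_neg, ← one_div]
    exact one_div_le_one_div_of_le two_pos (by have := Real.add_one_le_exp (1 : ℝ); linarith)
  have h4 := h2.trans h3
  rw [div_pow, div_le_iff₀ (by positivity)] at h4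
  have h5 : (2 : ℝ) * ((N - k : ℕ) : ℝ) ^ a ≤ (N : ℝ) ^ a := by
    rw [Nat.cast_sub hk]
    linarith
  exact_mod_cast h5

/-- Every `D` queries at least halve the version space, which starts with fewer than `2 ^ (n + 2) ^
2` families and always contains one for the target. -/
lemma halvingLearner_learnsWithin {b D : ℕ} (hD : 0 < D)
    (hhalf : ∀ 𝓥 : Finset (Finset (Finset (Fin n))), 𝓥.Nonempty → (∀ F ∈ 𝓥, F.card ≤ n) →
      ∃ H, IsHalving b D 𝓥 H) :
    (halvingLearner n b D).LearnsWithin IsEquivalenceTeacher (MonCNF (Fin n) n)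
      (D * (n + 2) ^ 2) := by
  intro φ hφ T hT
  obtain ⟨F₀, hF₀, hsat⟩ := exists_terms_of_mem_monCNF hφ
  set t := D * (n + 2) ^ 2 with ht
  refine (halvingLearner_progress hhalf hT hF₀ hsat t).resolve_right fun hle => ?_
  have hmem : F₀ ∈ versionSpace ((halvingLearner n b D).transcript T t) := by
    refine mem_versionSpace.2 ⟨hF₀, fun e he σ hσ => ?_⟩
    have h1 := hT e.1
    rw [← Learner.eq_of_mem_transcript _ T t e he, hσ] at h1
    have h2 := hsat σ
    simp only [EqAnswer.Correct] at h1
    tauto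
  have hpos : 0 < (versionSpace ((halvingLearner n b D).transcript T t)).card :=
    Finset.card_pos.2 ⟨F₀, hmem⟩
  have h1 : D ^ t ≤ (D - 1) ^ t * (2 ^ n + 1) ^ n :=
    (Nat.le_mul_of_pos_left _ hpos).trans hle
  have h2 : 2 ^ (n + 2) ^ 2 * (D - 1) ^ t ≤ D ^ t := by
    rw [ht, pow_mul, pow_mul, ← mul_pow]
    exact Nat.pow_le_pow_left (two_mul_sub_pow_le (by simp) hD hD) _
  have h3 : (2 ^ n + 1) ^ n < 2 ^ (n + 2) ^ 2 := by
    calc (2 ^ n + 1) ^ n ≤ (2 ^ (n + 1)) ^ n := by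
          refine Nat.pow_le_pow_left ?_ _
          have := Nat.one_le_two_pow (n := n)
          rw [pow_succ]; omega
      _ = 2 ^ ((n + 1) * n) := by rw [← pow_mul]
      _ < 2 ^ (n + 2) ^ 2 := Nat.pow_lt_pow_right (by norm_num) (by nlinarith)
  have h4 : 0 < (D - 1) ^ t := by
    refine Nat.pos_of_ne_zero fun h0 => ?_
    rw [h0, zero_mul] at h1
    exact absurd h1 (not_le.2 (pow_pos hD t))
  nlinarith

end Halving

/-! ### Lower bound for ICE-equivalence queries -/

section LowerBound

variable {n : ℕ}

/-- The terms of the monotone DNF for `toColex j ≤ toColex x`. -/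
def thresholdTerms (j : Finset (Fin n)) : Finset (Finset (Fin n)) :=
  insert j (jᶜ.image fun c => insert c (j.filter (c < ·)))

/-- If `x` exceeds `j`, the largest element `c` in which they differ lies in `x`, and `x` contains
all elements of `j` above `c`. -/
lemma covers_thresholdTerms (j x : Finset (Fin n)) :
    Covers (thresholdTerms j) x ↔ toColex j ≤ toColex x := by
  rw [le_iff_eq_or_lt, Finset.Colex.toColex_lt_toColex_iff_exists_forall_lt]
  constructor
  · rintro ⟨T, hT, hTx⟩
    rcases Finset.mem_insert.1 hT with rfl | hT
    · by_cases h : T = x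
      · exact Or.inl (by rw [h])
      · obtain ⟨a, ha, haT⟩ := Finset.exists_of_ssubset (hTx.ssubset_of_ne h)
        exact Or.inr ⟨a, ha, haT, fun b hb hbx => (hbx (hTx hb)).elim⟩
    · obtain ⟨c, hc, rfl⟩ := Finset.mem_image.1 hT
      obtain ⟨hcx, hj⟩ := Finset.insert_subset_iff.1 hTx
      have hcj : c ∉ j := by simpa using hc
      refine Or.inr ⟨c, hcx, hcj, fun b hb hbx => ?_⟩
      by_contra hlt
      rcases (not_lt.1 hlt).eq_or_lt with rfl | h
      · exact hbx hcx
      · exact hbx (hj (Finset.mem_filter.2 ⟨hb, h⟩))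
  · rintro (h | ⟨a, ha, haj, h⟩)
    · obtain rfl : j = x := by simpa using h
      exact ⟨j, Finset.mem_insert_self _ _, subset_rfl⟩
    · refine ⟨_, Finset.mem_insert_of_mem (Finset.mem_image_of_mem _ (by simpa using haj)),
        Finset.insert_subset ha fun b hb => ?_⟩
      obtain ⟨hbj, hab⟩ := Finset.mem_filter.1 hb
      by_contra hbx
      exact lt_asymm hab (h b hbj hbx)

lemma card_thresholdTerms_le {j : Finset (Fin n)} (hj : j.Nonempty) :
    (thresholdTerms j).card ≤ n := by
  have h1 : (thresholdTerms j).card ≤ jᶜ.card + 1 :=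
    (Finset.card_insert_le _ _).trans (Nat.succ_le_succ Finset.card_image_le)
  have h2 := Finset.card_compl_add_card j
  have h3 := Finset.card_pos.2 hj
  rw [Fintype.card_fin] at h2
  omega

/-- The monotone CNF formula that holds in the states below `j` in the colexicographic order. -/
noncomputable def thresholdFormula (j : Finset (Fin n)) : PropFormula (Fin n) :=
  monotoneCNF (thresholdTerms j)

lemma sat_thresholdFormula (j : Finset (Fin n)) (σ : Fin n → Bool) :
    (thresholdFormula j).Sat σ ↔ toColex (trueSet σ) < toColex j := by
  rw [thresholdFormula, sat_monotoneCNF, covers_thresholdTerms, not_le]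

lemma thresholdFormula_injective {j j' : Finset (Fin n)}
    (h : (thresholdFormula j).Equivalent (thresholdFormula j')) : j = j' := by
  have key : ∀ x : Finset (Fin n), toColex x < toColex j ↔ toColex x < toColex j' := by
    intro x
    have := h fun v => decide (v ∈ x)
    rwa [sat_thresholdFormula, sat_thresholdFormula, trueSet_decide_mem] at this
  rcases lt_trichotomy (toColex j) (toColex j') with hlt | heq | hlt
  · exact absurd ((key j).2 hlt) (lt_irrefl _)
  · simpa using heq
  · exact absurd ((key j').1 hlt) (lt_irrefl _)

/-- An answer to `θ` that is correct for all threshold formulas but one. -/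
lemma exists_universal_answer (θ : PropFormula (Fin n)) :
    ∃ (a : IceAnswer (Fin n)) (b : Finset (Fin n)), ∀ j, j.Nonempty → j ≠ b →
      a.Correct (thresholdFormula j) θ := by
  have hempty : ∀ j : Finset (Fin n), j.Nonempty → toColex (∅ : Finset (Fin n)) < toColex j := by
    intro j hj
    exact Finset.Colex.toColex_lt_toColex_of_ssubset (Finset.empty_ssubset.2 hj)
  have huniv : ∀ j : Finset (Fin n), ¬ toColex (Finset.univ : Finset (Fin n)) < toColex j := by
    intro j
    exact not_lt.2 (Finset.Colex.toColex_le_toColex_of_subset (Finset.subset_univ j))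
  let S : Finset (Fin n) → Prop := fun x => θ.Sat fun v => decide (v ∈ x)
  have : Finite (Colex (Finset (Fin n))) := inferInstanceAs (Finite (Finset (Fin n)))
  by_cases hconst : ∀ σ σ', θ.Sat σ → θ.Sat σ'
  -- A threshold formula with nonempty `j` is neither unsatisfiable nor valid: it holds at `∅` and
  -- fails at the full set. The exception `∅` is a dummy.
  · refine ⟨.inequivalent, ∅, fun j hj _ => ⟨fun heq => ?_, ?_⟩⟩
    · have h1 := heq fun v => decide (v ∈ (∅ : Finset (Fin n)))
      have h2 := heq fun v => decide (v ∈ (Finset.univ : Finset (Fin n)))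
      rw [sat_thresholdFormula, trueSet_decide_mem] at h1 h2
      exact huniv j (h2.1 (hconst _ _ (h1.2 (hempty j hj))))
    · rintro ⟨σ, σ', h1, h2, -⟩
      exact h2 (hconst _ _ h1)
  · push Not at hconst
    obtain ⟨σ, σ', hσ, hσ'⟩ := hconst
    by_cases hlt : ∃ b : Colex (Finset (Fin n)), ¬ S (ofColex b) ∧ ∃ a < b, S (ofColex a)
    -- Minimality of `b` and maximality of `a` leave nothing strictly between them, so only the
    -- threshold `j = b` satisfies `a < j ≤ b`.
    · obtain ⟨b, ⟨hb, a₀, ha₀, hSa₀⟩, hbmin⟩ :=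
        (wellFounded_lt (α := Colex (Finset (Fin n)))).has_min
          {b | ¬ S (ofColex b) ∧ ∃ a < b, S (ofColex a)} hlt
      obtain ⟨a, ⟨hab, hSa⟩, hamax⟩ :=
        (wellFounded_gt (α := Colex (Finset (Fin n)))).has_min
          {a | a < b ∧ S (ofColex a)} ⟨a₀, ha₀, hSa₀⟩
      refine ⟨.implication (fun v => decide (v ∈ ofColex a)) fun v => decide (v ∈ ofColex b),
        ofColex b, fun j _ hj => ⟨hSa, hb, ?_⟩⟩
      rw [sat_thresholdFormula, sat_thresholdFormula, trueSet_decide_mem, trueSet_decide_mem]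
      by_contra hcon
      push Not at hcon
      obtain ⟨haj, hjb⟩ := hcon
      have hjb' : toColex j < b := lt_of_le_of_ne hjb fun h => hj (by rw [← h]; rfl)
      by_cases hS : S j
      · exact hamax _ ⟨hjb', hS⟩ haj
      · exact hbmin _ ⟨hS, a, haj, hSa⟩ hjb'
    -- No falsifying state lies above a satisfying one, so no threshold can separate `σ < j ≤ σ'`.
    · refine ⟨.implication σ σ', ∅, fun j hj _ => ⟨hσ, hσ', ?_⟩⟩
      rw [sat_thresholdFormula, sat_thresholdFormula]
      by_contra hcon
      push Not at hcon
      refine hlt ⟨toColex (trueSet σ'), ?_, toColex (trueSet σ), hcon.1.trans_le hcon.2, ?_⟩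
      · simpa [S, trueSet] using hσ'
      · simpa [S, trueSet] using hσ

lemma exists_correct_iceAnswer {V : Type} (φ θ : PropFormula V) :
    ∃ a : IceAnswer V, a.Correct φ θ := by
  by_cases h : θ.Equivalent φ
  · exact ⟨.equivalent, h⟩
  · by_cases h' : ∃ σ σ', IsImplicationCex φ θ σ σ'
    · obtain ⟨σ, σ', h'⟩ := h'
      exact ⟨.implication σ σ', h'⟩
    · exact ⟨.inequivalent, h, h'⟩

lemma Learner.length_transcript_le {V R : Type} (A : Learner V R) (T : PropFormula V → R)
    (k : ℕ) : (A.transcript T k).length ≤ k := by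
  induction k with
  | zero => simp [Learner.transcript]
  | succ k ih =>
    rw [Learner.transcript]
    split
    · simpa using ih
    · omega

/-- Teachers that agree on the queries asked produce the same transcript. -/
lemma Learner.transcript_congr {V R : Type} (A : Learner V R) {T T' : PropFormula V → R}
    (k : ℕ) (h : ∀ e ∈ A.transcript T k, T' e.1 = T e.1) :
    A.transcript T' k = A.transcript T k := by
  induction k with
  | zero => rfl
  | succ k ih =>
    rw [Learner.transcript] at h
    rw [Learner.transcript, Learner.transcript]
    cases hact : A.act (A.transcript T k) with
    | output ψ =>
      simp only [hact] at h
      rw [ih h, hact]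
    | query θ =>
      simp only [hact] at h
      rw [ih fun e he => h e (List.mem_append_left _ he), hact]
      simp only [h (θ, T θ) (by simp)]

lemma ice_queries_lower_bound (A : Learner (Fin n) (IceAnswer (Fin n))) (t : ℕ)
    (hA : A.LearnsWithin IsIceTeacher (MonCNF (Fin n) n) t) : 2 ^ n ≤ t + 2 := by
  classical
  choose U b hU using exists_universal_answer (n := n)
  choose C hC using fun (j : Finset (Fin n)) => exists_correct_iceAnswer (thresholdFormula j)
  let killed : Finset (Finset (Fin n)) := ((A.transcript U t).map fun e => b e.1).toFinset
  have hkilled : killed.card ≤ t :=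
    (List.toFinset_card_le _).trans (by simpa using A.length_transcript_le U t)
  let alive : Finset (Finset (Fin n)) := (Finset.univ.erase ∅) \ killed
  have halive : 2 ^ n ≤ alive.card + t + 1 := by
    have h1 := Finset.le_card_sdiff killed (Finset.univ.erase (∅ : Finset (Fin n)))
    rw [Finset.card_erase_of_mem (Finset.mem_univ _)] at h1
    simp only [Finset.card_univ, Fintype.card_finset, Fintype.card_fin] at h1
    change 2 ^ n - 1 - killed.card ≤ alive.card at h1
    omega
  have hout : ∀ j ∈ alive, ∃ ψ, A.act (A.transcript U t) = .output ψ ∧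
      ψ.Equivalent (thresholdFormula j) := by
    intro j hj
    obtain ⟨hj0, hjk⟩ := Finset.mem_sdiff.1 hj
    have hne : j.Nonempty := Finset.nonempty_iff_ne_empty.2 (Finset.mem_erase.1 hj0).1
    -- This teacher departs from `U` only where `U` is wrong for `j`, which the learner never
    -- queries while `j` is alive.
    let T : PropFormula (Fin n) → IceAnswer (Fin n) := fun θ => if j = b θ then C j θ else U θ
    have hT : IsIceTeacher (thresholdFormula j) T := by
      intro θ
      by_cases h : j = b θ
      · simpa only [T, if_pos h] using hC j θ
      · simpa only [T, if_neg h] using hU θ j hne h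
    have htr : A.transcript T t = A.transcript U t := by
      refine A.transcript_congr t fun e he => if_neg fun h => hjk ?_
      exact List.mem_toFinset.2 (List.mem_map.2 ⟨e, he, h.symm⟩)
    rw [← htr]
    exact hA _ (monotoneCNF_mem (card_thresholdTerms_le hne)) T hT
  -- All surviving targets receive the same output, so there is at most one.
  have hone : alive.card ≤ 1 := by
    refine Finset.card_le_one.2 fun j hj j' hj' => ?_
    obtain ⟨ψ, hψ, he⟩ := hout j hj
    obtain ⟨ψ', hψ', he'⟩ := hout j' hj'
    obtain rfl : ψ = ψ' := by simpa [hψ] using hψ'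
    exact thresholdFormula_injective fun σ => (he σ).symm.trans (he' σ)
  omega

lemma eventually_rpow_le_of_two_pow_le :
    ∀ᶠ n : ℕ in Filter.atTop, ∀ t : ℕ, 2 ^ n ≤ t + 2 → (2 : ℝ) ^ ((1 / 2 : ℝ) * n) ≤ t := by
  filter_upwards [Filter.eventually_ge_atTop 2] with n hn t ht
  set y : ℝ := (2 : ℝ) ^ ((1 / 2 : ℝ) * n) with hy
  have h1 : y * y = (2 : ℝ) ^ n := by
    rw [hy, ← Real.rpow_add two_pos, ← Real.rpow_natCast]
    congr 1; ring
  have h2 : (2 : ℝ) ≤ y := by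
    calc (2 : ℝ) = (2 : ℝ) ^ (1 : ℝ) := (Real.rpow_one 2).symm
      _ ≤ y := Real.rpow_le_rpow_of_exponent_le one_le_two (by
        have : (2 : ℝ) ≤ n := by exact_mod_cast hn
        linarith)
  have h3 : (2 : ℝ) ^ n ≤ t + 2 := by exact_mod_cast ht
  nlinarith

end LowerBound

/-! ### Choice of parameters and growth rate -/

/-- The exponent in the number of queries of the halving learner. -/
def halvingExponent (n : ℕ) : ℕ :=
  Nat.sqrt (n + 1) + (Nat.sqrt (n + 1) + 2) * (Nat.log 2 n + 1)

/-- Since `n + 1 ≤ k * (k + 2)`, each block of `k + 2` levels halves the term bound, and `Nat.log 2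
n + 1` halvings bring `n` below `1`. -/
lemma sqrt_level_bound (n : ℕ) :
    n * (n + 1 - Nat.sqrt (n + 1)) ^ ((Nat.sqrt (n + 1) + 2) * (Nat.log 2 n + 1)) <
      (n + 1) ^ ((Nat.sqrt (n + 1) + 2) * (Nat.log 2 n + 1)) := by
  set k := Nat.sqrt (n + 1) with hk
  have h1 : 2 * (n + 1 - k) ^ (k + 2) ≤ (n + 1) ^ (k + 2) := by
    refine two_mul_sub_pow_le ?_ (Nat.sqrt_le_self _) (Nat.succ_pos _)
    have := Nat.lt_succ_sqrt (n + 1)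
    rw [← hk, Nat.succ_eq_add_one] at this
    nlinarith
  have h2 : 2 ^ (Nat.log 2 n + 1) * (n + 1 - k) ^ ((k + 2) * (Nat.log 2 n + 1)) ≤
      (n + 1) ^ ((k + 2) * (Nat.log 2 n + 1)) := by
    rw [pow_mul, pow_mul, ← mul_pow]
    exact Nat.pow_le_pow_left h1 _
  rcases Nat.eq_zero_or_pos ((n + 1 - k) ^ ((k + 2) * (Nat.log 2 n + 1))) with h0 | h0
  · rw [h0, mul_zero]
    positivity
  · exact (Nat.mul_lt_mul_of_pos_right (Nat.lt_pow_succ_log_self one_lt_two n) h0).trans_le h2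

lemma exists_isHalving (n : ℕ) (𝓥 : Finset (Finset (Finset (Fin n)))) (hne : 𝓥.Nonempty)
    (hcard : ∀ F ∈ 𝓥, F.card ≤ n) :
    ∃ H, IsHalving ((n + 2) ^ (halvingExponent n + 3)) ((n + 2) ^ (halvingExponent n + 1)) 𝓥 H := by
  have hs := sqrt_level_bound n
  set k := Nat.sqrt (n + 1)
  set J := (k + 2) * (Nat.log 2 n + 1)
  have hexp : halvingExponent n = k + J := rfl
  have h1 : (n + 1) ^ k ≤ (n + 2) ^ k := Nat.pow_le_pow_left (Nat.le_succ _) _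
  have h2 : (n + 1) ^ J ≤ (n + 2) ^ J := Nat.pow_le_pow_left (Nat.le_succ _) _
  have h3 : 1 ≤ (n + 2) ^ k := Nat.one_le_pow _ _ (Nat.succ_pos _)
  obtain ⟨H, hH, hH'⟩ := exists_halving_terms hne (k := k) (J := J)
    (D := (n + 2) ^ (halvingExponent n + 1)) hcard (by simpa using hs) (by
      rw [Fintype.card_fin, hexp, add_right_comm, pow_add]
      refine Nat.mul_le_mul ?_ h2
      rw [pow_succ]
      nlinarith)
  refine ⟨H, hH.trans ?_, hH'⟩
  rw [Fintype.card_fin]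
  calc (n + 1) ^ k * (n + 2) ^ J ≤ (n + 2) ^ k * (n + 2) ^ J := Nat.mul_le_mul_right _ h1
    _ = (n + 2) ^ (k + J) := (pow_add _ _ _).symm
    _ ≤ _ := Nat.pow_le_pow_right (Nat.succ_pos _) (by omega)

lemma halvingExponent_mul_log_le (n : ℕ) :
    ((halvingExponent n + 3 : ℕ) : ℝ) * Real.logb 2 (n + 2) ≤
      10 * (Real.sqrt (n + 2) * Real.logb 2 (n + 2) ^ 2) := by
  set L := Real.logb 2 (n + 2) with hL
  set r := Real.sqrt (n + 2) with hr
  have hn : (0 : ℝ) ≤ n := Nat.cast_nonneg n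
  have hL1 : 1 ≤ L := by
    rw [hL, Real.le_logb_iff_rpow_le one_lt_two (by linarith)]
    simp
  have hr1 : 1 ≤ r := by
    rw [hr]
    exact Real.one_le_sqrt.2 (by linarith)
  have hk : (Nat.sqrt (n + 1) : ℝ) ≤ r := by
    refine Real.le_sqrt_of_sq_le ?_
    have : ((Nat.sqrt (n + 1) ^ 2 : ℕ) : ℝ) ≤ ((n + 1 : ℕ) : ℝ) := by
      exact_mod_cast Nat.sqrt_le' (n + 1)
    push_cast at this
    linarith
  have hlog : (Nat.log 2 n : ℝ) ≤ L := by
    rcases Nat.eq_zero_or_pos n with rfl | hpos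
    · simpa using by linarith
    · rw [hL, Real.le_logb_iff_rpow_le one_lt_two (by linarith), Real.rpow_natCast]
      have : ((2 ^ Nat.log 2 n : ℕ) : ℝ) ≤ n := by
        exact_mod_cast Nat.pow_log_le_self 2 hpos.ne'
      push_cast at this
      linarith
  have h1 : ((halvingExponent n + 3 : ℕ) : ℝ) ≤ 10 * (r * L) := by
    unfold halvingExponent
    push_cast
    have h2 : ((Nat.sqrt (n + 1) : ℝ) + 2) * (Nat.log 2 n + 1) ≤ (r + 2) * (L + 1) := by
      gcongr
    have h3 : 0 ≤ (r - 1) * (L - 1) := mul_nonneg (by linarith) (by linarith)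
    nlinarith
  calc _ ≤ 10 * (r * L) * L := mul_le_mul_of_nonneg_right h1 (by linarith)
    _ = _ := by ring

lemma subexponential_halving :
    Subexponential fun n => (n + 2) ^ (halvingExponent n + 3) := by
  intro ε hε
  have h1 : (fun x : ℝ => Real.log x ^ (2 : ℝ)) =o[Filter.atTop] fun x => x ^ (1 / 2 : ℝ) :=
    isLittleO_log_rpow_rpow_atTop 2 (by norm_num)
  -- With this constant the exponent is at most `ε / 2 * (n + 2)`, hence at most `ε * n` once `n ≥
  -- 2`.
  have hc : 0 < ε * Real.log 2 ^ 2 / 20 := by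
    have := Real.log_pos one_lt_two
    positivity
  have h2 := h1.bound hc
  have h3 : Filter.Tendsto (fun n : ℕ => (n : ℝ) + 2) Filter.atTop Filter.atTop :=
    Filter.tendsto_atTop_add_const_right _ _ tendsto_natCast_atTop_atTop
  filter_upwards [h3.eventually h2, Filter.eventually_ge_atTop 2] with n hn hn2
  have hn2' : (2 : ℝ) ≤ n := by exact_mod_cast hn2
  have hpos : (0 : ℝ) < n + 2 := by linarith
  rw [← Real.sqrt_eq_rpow, Real.rpow_two, Real.norm_of_nonneg (sq_nonneg _),
    Real.norm_of_nonneg (Real.sqrt_nonneg _)] at hn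
  have hlog2 : (0 : ℝ) < Real.log 2 ^ 2 := by
    have := Real.log_pos one_lt_two
    positivity
  have h4 : Real.logb 2 (n + 2) ^ 2 ≤ ε / 20 * Real.sqrt (n + 2) := by
    rw [Real.logb, div_pow, div_le_iff₀ hlog2]
    linarith
  have h5 : ((halvingExponent n + 3 : ℕ) : ℝ) * Real.logb 2 (n + 2) ≤ ε * n := by
    refine (halvingExponent_mul_log_le n).trans ?_
    calc 10 * (Real.sqrt (n + 2) * Real.logb 2 (n + 2) ^ 2)
        ≤ 10 * (Real.sqrt (n + 2) * (ε / 20 * Real.sqrt (n + 2))) := by gcongr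
      _ = ε / 2 * (Real.sqrt (n + 2) * Real.sqrt (n + 2)) := by ring
      _ = ε / 2 * (n + 2) := by rw [Real.mul_self_sqrt hpos.le]
      _ ≤ ε * n := by nlinarith
  calc (((n + 2) ^ (halvingExponent n + 3) : ℕ) : ℝ)
      = ((2 : ℝ) ^ Real.logb 2 (n + 2)) ^ (halvingExponent n + 3) := by
        rw [Real.rpow_logb two_pos (by norm_num) hpos]
        push_cast
        rfl
    _ = (2 : ℝ) ^ (((halvingExponent n + 3 : ℕ) : ℝ) * Real.logb 2 (n + 2)) := by
        rw [← Real.rpow_natCast, ← Real.rpow_mul two_pos.le, mul_comm]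
    _ ≤ (2 : ℝ) ^ (ε * n) := Real.rpow_le_rpow_of_exponent_le one_le_two h5

theorem mainTheorem5 :
    (∃ q : ℕ → ℕ, Subexponential q ∧
      ∀ n : ℕ, ∃ A : Learner (Fin n) (EqAnswer (Fin n)),
        A.QueriesIn (MonCNF (Fin n) (q n)) ∧
        A.LearnsWithin IsEquivalenceTeacher (MonCNF (Fin n) n) (q n)) ∧
    (∃ c : ℝ, 0 < c ∧ ∀ᶠ n : ℕ in Filter.atTop,
      ∀ (A : Learner (Fin n) (IceAnswer (Fin n))) (t : ℕ),
        A.LearnsWithin IsIceTeacher (MonCNF (Fin n) n) t →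
          (2 : ℝ) ^ (c * n) ≤ t) := by
  refine ⟨⟨_, subexponential_halving, fun n => ⟨_, halvingLearner_queriesIn _
    ((n + 2) ^ (halvingExponent n + 1)), ?_⟩⟩, 1 / 2, by norm_num, ?_⟩
  · have h := halvingLearner_learnsWithin (by positivity) (exists_isHalving n)
    rwa [← pow_add] at h
  · filter_upwards [eventually_rpow_le_of_two_pow_le] with n hn A t hA
    exact hn t (ice_queries_lower_bound A t hA)
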